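/- For a positive integer $n$ let $S_n$ be the set of permutations of $[n]=\{1,\dots,n\}$. Let $X_1,\dots,X_n$ be independent random variables with values in $[0,\infty)$ and let $\pi\in S_n$. A stopping rule adapted to $X_{\pi(1)},\dots,X_{\pi(n)}$ is a random variable $\tau$ with values in $[n]\cup\{\infty\}$ such that for every $k\in[n]$ the event $\{\tau=k\}$ is measurable with respect to the $\sigma$-field generated by $X_{\pi(1)},\dots,X_{\pi(k)}$; it selects the value $X_{\pi(\tau)}$, or $0$ if $\tau=\infty$. It is a threshold stopping rule with threshold $\theta\in\mathbb R$ if for all $k$, $X_{\pi(k)}<\theta$ implies $\tau\ne k$, and $X_{\pi(k)}>\theta$ implies $\tau\le k$ (if $X_{\pi(k)}=\theta$, both decisions are allowed). For a non-empty set $\Pi\subseteq S_n$, the threshold prophet ratio $\mathsf{TPR}(\Pi)$ is the supremum of all $\alpha$ such that for all distributions of $X_1,\dots,X_n$ on $[0,\infty)$ there are a $\pi\in\Pi$ and a threshold stopping rule adapted to $X_{\pi(1)},\dots,X_{\pi(n)}$ for which the expectation of the selected value is at least $\alpha\cdot\mathbb E[\max_{1\le i\le n}X_i]$. Theorem. There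 is a polynomial $P$ with real coefficients such that for every integer $n\ge 2$ and every $\varepsilon>0$ there is a non-empty set $\Pi\subseteq S_n$ with $|\Pi|\le P(1/\varepsilon)\cdot\log n$ and $\mathsf{TPR}(\Pi)>1-\frac1e-\varepsilon$. Moreover, there is a constant $C$ such that for every integer $n\ge 1$ there is a non-empty set $\Pi\subseteq S_n$ with $|\Pi|\le C n^2$ and $\mathsf{TPR}(\Pi)\ge 1-\frac1e$. -/

import Mathlib

open MeasureTheory
open scoped NNReal ENNReal

noncomputable section

namespace Prophet

/-- The sequence `X_{π(1)}, …, X_{π(n)}` on the canonical sample space of `n`-tuples of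
non-negative reals, on which `X_i` is the `i`-th coordinate. -/
def reorder {n : ℕ} (π : Equiv.Perm (Fin n)) (k : Fin n) (x : Fin n → ℝ≥0) : ℝ≥0 :=
  x (π k)

theorem stronglyMeasurable_reorder {n : ℕ} (π : Equiv.Perm (Fin n)) (k : Fin n) :
    StronglyMeasurable (reorder π k) :=
  (measurable_pi_apply (π k)).stronglyMeasurable

/-- The filtration whose `k`-th member is generated by `X_{π(1)}, …, X_{π(k)}`. -/
def observed {n : ℕ} (π : Equiv.Perm (Fin n)) :
    Filtration (Fin n) (inferInstance : MeasurableSpace (Fin n → ℝ≥0)) :=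
  Filtration.natural (reorder π) (stronglyMeasurable_reorder π)

/-- `τ` is a threshold rule with threshold `θ` for the sequence `Y`: it never selects a value
strictly less than `θ`, and it has stopped by the time at which a value strictly greater than `θ`
is seen; when a value equals `θ`, either decision is allowed. Here `τ ω` is the time of the
selection, and `τ ω = ⊤` means that nothing is selected. -/
structure IsThresholdRule {Ω : Type*} {n : ℕ} (Y : Fin n → Ω → ℝ≥0) (θ : ℝ)
    (τ : Ω → WithTop (Fin n)) : Prop where
  ne_of_lt : ∀ (ω : Ω) (k : Fin n), (Y k ω : ℝ) < θ → τ ω ≠ (k : WithTop (Fin n))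
  le_of_gt : ∀ (ω : Ω) (k : Fin n), θ < (Y k ω : ℝ) → τ ω ≤ (k : WithTop (Fin n))

/-- The value selected by `τ` from the sequence `Y`, which is `0` if nothing is selected. -/
def selected {Ω : Type*} {n : ℕ} (Y : Fin n → Ω → ℝ≥0) (τ : Ω → WithTop (Fin n)) (ω : Ω) : ℝ≥0 :=
  WithTop.recTopCoe (C := fun _ => ℝ≥0) 0 (fun k => Y k ω) (τ ω)

/-- The set `S` of permutations satisfies the constrained-order threshold prophet inequality with
factor `α`: for all distributions `μ 1, …, μ n` on the non-negative reals, if `X_1, …, X_n` are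
independent with these distributions, then there are a permutation `π ∈ S` and a threshold stopping
rule `τ` adapted to `X_{π(1)}, …, X_{π(n)}` with `𝔼 X_τ ≥ α * 𝔼 (max_i X_i)`. Expectations are
in `[0, ∞]`, so that no integrability is needed. -/
def ThresholdProphetInequality {n : ℕ} (S : Set (Equiv.Perm (Fin n))) (α : ℝ) : Prop :=
  ∀ μ : Fin n → ProbabilityMeasure ℝ≥0,
    ∃ π ∈ S, ∃ (θ : ℝ) (τ : (Fin n → ℝ≥0) → WithTop (Fin n)),
      IsStoppingTime (observed π) τ ∧
      IsThresholdRule (reorder π) θ τ ∧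
      ENNReal.ofReal α *
          ∫⁻ x, ((Finset.univ.sup x : ℝ≥0) : ℝ≥0∞) ∂(Measure.pi fun i => (μ i : Measure ℝ≥0)) ≤
        ∫⁻ x, ((selected (reorder π) τ x : ℝ≥0) : ℝ≥0∞)
          ∂(Measure.pi fun i => (μ i : Measure ℝ≥0))

/-- The threshold prophet ratio of `S`: the supremum of all factors `α` for which `S` satisfies the
constrained-order threshold prophet inequality. For `1 ≤ n` and nonempty `S` these factors form a
nonempty set that is bounded above by `1`. -/
def TPR {n : ℕ} (S : Set (Equiv.Perm (Fin n))) : ℝ :=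
  sSup {α : ℝ | ThresholdProphetInequality S α}

end Prophet

end

/-! Fix a threshold `θ` and a tie-accepting probability for which nothing is accepted with
probability exactly `1/e`. Let `ρ i` be the probability that `X_i` is rejected; the weights `-log (ρ
j)` are nonnegative and sum to 1. In the order `π` the rule earns `θ (1 - 1/e) + ∑ i, P(i is
reached) E(X_i - θ)⁺` (`payoff_eq`), while `E max ≤ θ + ∑ i, E(X_i - θ)⁺` (`lintegral_sup_le`). So
it suffices that for each `i` the probability of reaching `i`, averaged over the family of orders,
is at least `c ≤ 1 - 1/e`; some order then does as well as the average.

That probability is `exp (-R)`, with `R` the total weight before `i`. A tangent line of `exp (-x)`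
bounds it below by a weighted average over `j` of `pairScore`, which no longer involves the
distributions. What remains is a condition on pairs `(i, j)`
(`thresholdProphetInequality_of_pairScore`).

For a prime `n < p ≤ 2n`, the maps `x ↦ a x + b` over `ZMod p` are sharply 2-transitive, so all `p
(p - 1)` of them together satisfy the condition with `c = 1 - 1/e` (`le_sum_pairScore_affineOrder`).
For the logarithmic bound, a sample of these maps meets all `n²` pair conditions up to `δ`
(`exists_sample`).

Random tie-breaking is removed at the end, since the payoff is affine in each variable's decision
(`exists_le_payoff_ite`). -/

namespace Prophet

/-! ### Rules given by acceptance sets -/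

/-- The rule that accepts the first value `X_{π(k)}` lying in `B (π k)`. -/
noncomputable def firstHit {n : ℕ} (π : Equiv.Perm (Fin n)) (B : Fin n → Set ℝ≥0)
    (x : Fin n → ℝ≥0) : WithTop (Fin n) :=
  open Classical in (Finset.univ.filter fun k => x (π k) ∈ B (π k)).min

section firstHit

variable {n : ℕ} {π : Equiv.Perm (Fin n)} {B : Fin n → Set ℝ≥0} {x : Fin n → ℝ≥0}

theorem firstHit_le {k : Fin n} (h : x (π k) ∈ B (π k)) : firstHit π B x ≤ k :=
  Finset.min_le (by simpa using h)

theorem mem_of_firstHit_eq {k : Fin n} (h : firstHit π B x = k) : x (π k) ∈ B (π k) := by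
  classical
  simpa using Finset.mem_of_min (s := Finset.univ.filter fun k => x (π k) ∈ B (π k))
    (by rw [← h, firstHit])

theorem firstHit_eq {k : Fin n} (h : x (π k) ∈ B (π k))
    (h' : ∀ l < k, x (π l) ∉ B (π l)) : firstHit π B x = k := by
  refine le_antisymm (firstHit_le h) ?_
  refine Finset.le_min fun l hl => ?_
  rw [WithTop.coe_le_coe]
  by_contra! hlt
  exact h' l hlt (by simpa using hl)

theorem firstHit_le_iff {k : Fin n} :
    firstHit π B x ≤ k ↔ ∃ l ≤ k, x (π l) ∈ B (π l) := by
  constructor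
  · intro h
    obtain ⟨l, hl⟩ := WithTop.ne_top_iff_exists.1 (ne_top_of_le_ne_top WithTop.coe_ne_top h)
    exact ⟨l, by rwa [← hl, WithTop.coe_le_coe] at h, mem_of_firstHit_eq hl.symm⟩
  · rintro ⟨l, hl, h⟩
    exact (firstHit_le h).trans (WithTop.coe_le_coe.2 hl)

theorem isStoppingTime_firstHit (hB : ∀ i, MeasurableSet (B i)) :
    IsStoppingTime (observed π) (firstHit π B) := by
  intro k
  have : {x | firstHit π B x ≤ k} = ⋃ l ∈ Finset.Iic k, reorder π l ⁻¹' B (π l) := by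
    ext x
    simp [firstHit_le_iff, reorder]
  rw [this]
  refine Finset.measurableSet_biUnion _ fun l hl => ?_
  have h1 : MeasurableSet[observed π l] (reorder π l ⁻¹' B (π l)) :=
    ((Filtration.stronglyAdapted_natural (stronglyMeasurable_reorder π) l).measurable) (hB _)
  exact (observed π).mono (Finset.mem_Iic.1 hl) _ h1

theorem isThresholdRule_firstHit {θ : ℝ≥0} (h₁ : ∀ i, Set.Ioi θ ⊆ B i)
    (h₂ : ∀ i, B i ⊆ Set.Ici θ) : IsThresholdRule (reorder π) θ (firstHit π B) where
  ne_of_lt x k hk h := by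
    have := h₂ _ (mem_of_firstHit_eq h)
    exact absurd (NNReal.coe_lt_coe.1 hk) (not_lt.2 this)
  le_of_gt x k hk := firstHit_le (h₁ _ (NNReal.coe_lt_coe.1 hk))

/-- The expected value of a first-hit rule, given for each variable the probability of rejection
and the expected accepted value. -/
noncomputable def payoff (π : Equiv.Perm (Fin n)) (q : Fin n → ℝ≥0∞ × ℝ≥0∞) : ℝ≥0∞ :=
  ∑ k, (∏ l with l < k, (q (π l)).1) * (q (π k)).2

/-- Only the term of the first hit survives: earlier terms lack an accepted value, later ones
contain the vanishing rejection factor of the hit. -/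
theorem sum_indicator_le_selected :
    ∑ k, (∏ l with l < k, (B (π l))ᶜ.indicator 1 (x (π l))) *
      (B (π k)).indicator (fun y => (y : ℝ≥0∞)) (x (π k)) ≤
      (selected (reorder π) (firstHit π B) x : ℝ≥0∞) := by
  by_cases h : ∃ k : Fin n, firstHit π B x = (k : WithTop (Fin n))
  · obtain ⟨k, hk⟩ := h
    have hmem := mem_of_firstHit_eq hk
    rw [Finset.sum_eq_single k]
    · have hsel : selected (reorder π) (firstHit π B) x = x (π k) := by
        simp only [selected, hk]; rfl
      rw [hsel, Set.indicator_of_mem hmem]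
      refine mul_le_of_le_one_left' (Finset.prod_le_one' fun l _ => ?_)
      exact Set.indicator_le_self' (by simp) _
    · intro l _ hl
      rcases lt_or_gt_of_ne hl with hl | hl
      · have : x (π l) ∉ B (π l) := fun h => by
          have := firstHit_le h
          rw [hk, WithTop.coe_le_coe] at this
          exact absurd hl (not_lt.2 this)
        rw [Set.indicator_of_notMem this, mul_zero]
      · rw [Finset.prod_eq_zero (i := k) (by simpa using hl), zero_mul]
        exact Set.indicator_of_notMem (by simpa using hmem) _
    · simp
  · push Not at h
    refine le_of_eq_of_le (Finset.sum_eq_zero fun k _ => ?_) zero_le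
    have : x (π k) ∉ B (π k) := fun hk => by
      obtain ⟨l, hl⟩ := WithTop.ne_top_iff_exists.1
        (ne_top_of_le_ne_top WithTop.coe_ne_top (firstHit_le hk))
      exact h l hl.symm
    rw [Set.indicator_of_notMem this, mul_zero]

theorem payoff_le_lintegral_selected (μ : Fin n → Measure ℝ≥0) [∀ i, IsProbabilityMeasure (μ i)]
    (hB : ∀ i, MeasurableSet (B i)) :
    payoff π (fun i => (μ i (B i)ᶜ, ∫⁻ y in B i, y ∂μ i)) ≤
      ∫⁻ x, (selected (reorder π) (firstHit π B) x : ℝ≥0∞) ∂Measure.pi μ := by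
  refine le_trans (le_of_eq ?_) (lintegral_mono fun x => sum_indicator_le_selected)
  have m1 : ∀ i, Measurable ((B i)ᶜ.indicator (1 : ℝ≥0 → ℝ≥0∞)) := fun i =>
    measurable_one.indicator (hB i).compl
  have m2 : ∀ i, Measurable ((B i).indicator (fun y : ℝ≥0 => (y : ℝ≥0∞))) := fun i =>
    measurable_coe_nnreal_ennreal.indicator (hB i)
  rw [lintegral_finsetSum]
  · refine Finset.sum_congr rfl fun k _ => ?_
    -- One family holding both the value factor at `π k` and the rejection factors, so that
    -- independence applies to a single product.
    let f : Fin n → ℝ≥0 → ℝ≥0∞ := fun i => if i = π k then (B i).indicator (fun y => (y : ℝ≥0∞))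
      else (B i)ᶜ.indicator 1
    have mf : ∀ i, Measurable (f i) := fun i => by
      simp only [f]; split_ifs
      exacts [m2 i, m1 i]
    let s : Finset (Fin n) := (Finset.univ.filter (· < k)).map π.toEmbedding
    have hs : π k ∉ s := by simp [s]
    have key := ProbabilityTheory.lintegral_prod_eq_prod_lintegral_of_indepFun (insert (π k) s)
      (fun i (x : Fin n → ℝ≥0) => f i (x i))
      (ProbabilityTheory.iIndepFun_pi (μ := μ) (X := f) fun i => (mf i).aemeasurable)
      (fun i => (mf i).comp (measurable_pi_apply i))
    have ev : ∀ i, ∫⁻ x, f i (x i) ∂Measure.pi μ = ∫⁻ y, f i y ∂μ i := fun i =>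
      (measurePreserving_eval μ i).lintegral_comp (mf i)
    simp only [ev, Finset.prod_insert hs, s, Finset.prod_map, Equiv.coe_toEmbedding] at key
    have e1 : ∀ y, f (π k) y = (B (π k)).indicator (fun y => (y : ℝ≥0∞)) y := by simp [f]
    have e2 : ∀ l ∈ Finset.univ.filter (· < k), ∀ y,
        f (π l) y = (B (π l))ᶜ.indicator 1 y := fun l hl y => by
      have : l ≠ k := ne_of_lt (by simpa using hl)
      simp [f, this]
    have e3 : ∀ x : Fin n → ℝ≥0, ∏ l with l < k, f (π l) (x (π l)) =
        ∏ l with l < k, (B (π l))ᶜ.indicator 1 (x (π l)) := fun x =>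
      Finset.prod_congr rfl fun l hl => e2 l hl _
    have e4 : ∏ l with l < k, ∫⁻ y, f (π l) y ∂μ (π l) = ∏ l with l < k, μ (π l) (B (π l))ᶜ :=
      Finset.prod_congr rfl fun l hl => by
        simp_rw [e2 l hl]
        exact lintegral_indicator_one (hB _).compl
    simp_rw [e1, e3, e4] at key
    rw [lintegral_indicator (hB _)] at key
    simp_rw [mul_comm _ ((B (π k)).indicator _ _)]
    rw [key, mul_comm]
  · intro k _
    have h₁ : ∀ l, Measurable fun x : Fin n → ℝ≥0 => (B (π l))ᶜ.indicator (1 : ℝ≥0 → ℝ≥0∞) (x (π l)) :=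
      fun l => (m1 _).comp (measurable_pi_apply _)
    have h₂ : Measurable fun x : Fin n → ℝ≥0 =>
        (B (π k)).indicator (fun y : ℝ≥0 => (y : ℝ≥0∞)) (x (π k)) :=
      (m2 _).comp (measurable_pi_apply _)
    exact (Finset.measurable_fun_prod _ fun l _ => h₁ l).mul h₂

end firstHit

/-! ### Derandomisation of the tie-breaking -/

/-- Each summand of the payoff involves `q i` at most once, as a rejection factor or as the accepted
value, so the payoff is affine in `q i`. -/
theorem payoff_update {n : ℕ} (π : Equiv.Perm (Fin n)) (q : Fin n → ℝ≥0∞ × ℝ≥0∞) (i : Fin n)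
    {v w : ℝ≥0∞} (hvw : v + w = 1) (a b : ℝ≥0∞ × ℝ≥0∞)
    (h₁ : (q i).1 = v * a.1 + w * b.1) (h₂ : (q i).2 = v * a.2 + w * b.2) :
    payoff π q = v * payoff π (Function.update q i a) + w * payoff π (Function.update q i b) := by
  obtain ⟨k₀, rfl⟩ := π.surjective i
  simp only [payoff, Finset.mul_sum, ← Finset.sum_add_distrib]
  have hne : ∀ l, l ≠ k₀ → ∀ c, Function.update q (π k₀) c (π l) = q (π l) := fun l hl c =>
    Function.update_of_ne (fun h => hl (π.injective h)) _ _
  refine Finset.sum_congr rfl fun k _ => ?_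
  by_cases hk : k₀ < k
  · have hmem : k₀ ∈ Finset.univ.filter (· < k) := by simpa using hk
    have hpr : ∀ c : ℝ≥0∞ × ℝ≥0∞, ∏ l with l < k, (Function.update q (π k₀) c (π l)).1 =
        c.1 * ∏ l ∈ (Finset.univ.filter (· < k)).erase k₀, (q (π l)).1 := fun c => by
      rw [← Finset.mul_prod_erase _ _ hmem, Function.update_self]
      congr 1
      exact Finset.prod_congr rfl fun l hl => by rw [hne l (Finset.ne_of_mem_erase hl)]
    rw [hpr, hpr, hne k hk.ne', hne k hk.ne', ← Finset.mul_prod_erase _ _ hmem, h₁]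
    ring
  · have hpr : ∀ c : ℝ≥0∞ × ℝ≥0∞, ∏ l with l < k, (Function.update q (π k₀) c (π l)).1 =
        ∏ l with l < k, (q (π l)).1 := fun c =>
      Finset.prod_congr rfl fun l hl => by
        rw [hne l]
        rintro rfl
        exact hk (by simpa using hl)
    rw [hpr, hpr]
    by_cases hkk : k = k₀
    · subst hkk
      rw [Function.update_self, Function.update_self, h₂]
      ring
    · rw [hne k hkk, hne k hkk, mul_left_comm, mul_left_comm w, ← mul_add, ← add_mul, hvw, one_mul]

/-- A convex combination is at most the larger of its endpoints; the mixtures are replaced one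
variable at a time. -/
theorem exists_le_payoff_ite {n : ℕ} (π : Equiv.Perm (Fin n)) (q a b : Fin n → ℝ≥0∞ × ℝ≥0∞)
    {v w : ℝ≥0∞} (hvw : v + w = 1)
    (h₁ : ∀ i, (q i).1 = v * (a i).1 + w * (b i).1)
    (h₂ : ∀ i, (q i).2 = v * (a i).2 + w * (b i).2) :
    ∃ A : Finset (Fin n), payoff π q ≤ payoff π (fun i => if i ∈ A then a i else b i) := by
  suffices h : ∀ s : Finset (Fin n), ∃ A : Finset (Fin n), payoff π q ≤
      payoff π (fun i => if i ∈ s then (if i ∈ A then a i else b i) else q i) by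
    simpa using h Finset.univ
  intro s
  induction s using Finset.induction_on with
  | empty => exact ⟨∅, by simp⟩
  | insert j s hj ih =>
    obtain ⟨A, hA⟩ := ih
    set f : Fin n → ℝ≥0∞ × ℝ≥0∞ := fun i => if i ∈ s then (if i ∈ A then a i else b i) else q i
    have hf : f j = q j := by simp [f, hj]
    have hup := payoff_update π f j hvw (a j) (b j) (by rw [hf, h₁]) (by rw [hf, h₂])
    have ea : Function.update f j (a j) =
        fun i => if i ∈ insert j s then (if i ∈ insert j A then a i else b i) else q i := by
      ext1 i
      by_cases hi : i = j
      · subst hi; simp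
      · simp [hi, f]
    have eb : Function.update f j (b j) =
        fun i => if i ∈ insert j s then (if i ∈ A.erase j then a i else b i) else q i := by
      ext1 i
      by_cases hi : i = j
      · subst hi; simp
      · simp [hi, f]
    by_cases hab : payoff π (Function.update f j (a j)) ≤ payoff π (Function.update f j (b j))
    · refine ⟨A.erase j, hA.trans ?_⟩
      rw [← eb, hup]
      calc _ ≤ v * payoff π (Function.update f j (b j)) +
            w * payoff π (Function.update f j (b j)) := by gcongr
        _ = _ := by rw [← add_mul, hvw, one_mul]
    · refine ⟨insert j A, hA.trans ?_⟩
      rw [← ea, hup]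
      have := (not_le.1 hab).le
      calc _ ≤ v * payoff π (Function.update f j (a j)) +
            w * payoff π (Function.update f j (a j)) := by gcongr
        _ = _ := by rw [← add_mul, hvw, one_mul]

/-! ### Choice of the threshold -/

theorem exists_quantile (ν : Measure ℝ≥0) [IsProbabilityMeasure ν] {c : ℝ≥0∞} (hc : c < 1) :
    ∃ θ, ν (Set.Iio θ) ≤ c ∧ c ≤ ν (Set.Iic θ) := by
  set S : Set ℝ≥0 := {s | c ≤ ν (Set.Iic s)}
  have hne : S.Nonempty := by
    have h := tendsto_measure_Iic_atTop ν
    rw [measure_univ] at h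
    obtain ⟨s, hs⟩ := (h.eventually (lt_mem_nhds hc)).exists
    exact ⟨s, hs.le⟩
  have hbd : BddBelow S := OrderBot.bddBelow S
  refine ⟨sInf S, ?_, ?_⟩
  · rcases eq_or_ne (sInf S) 0 with h0 | h0
    · simp [h0]
    · obtain ⟨u, hu, hlt, hlim⟩ := exists_seq_strictMono_tendsto' (pos_iff_ne_zero.2 h0)
      have hU : Set.Iio (sInf S) = ⋃ k, Set.Iic (u k) := by
        ext y
        simp only [Set.mem_Iio, Set.mem_iUnion, Set.mem_Iic]
        constructor
        · intro hy
          exact ((hlim.eventually (lt_mem_nhds hy)).exists).imp fun _ h => h.le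
        · rintro ⟨k, hk⟩
          exact hk.trans_lt (hlt k).2
      have hmono : Monotone fun k => Set.Iic (u k) := fun i j hij =>
        Set.Iic_subset_Iic.2 (hu.monotone hij)
      rw [hU, hmono.measure_iUnion]
      refine iSup_le fun k => ?_
      have : u k ∉ S := notMem_of_lt_csInf (hlt k).2 hbd
      exact (not_le.1 this).le
  · obtain ⟨u, hu, hlt, hlim⟩ := exists_seq_strictAnti_tendsto (sInf S)
    have hU : Set.Iic (sInf S) = ⋂ k, Set.Iic (u k) := by
      ext y
      simp only [Set.mem_iInter, Set.mem_Iic]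
      exact ⟨fun hy k => hy.trans (hlt k).le, fun h => ge_of_tendsto' hlim h⟩
    have hmono : Antitone fun k => Set.Iic (u k) := fun i j hij =>
      Set.Iic_subset_Iic.2 (hu.antitone hij)
    rw [hU, hmono.measure_iInter (fun _ => measurableSet_Iic.nullMeasurableSet)
      ⟨0, measure_ne_top _ _⟩]
    refine le_iInf fun k => ?_
    obtain ⟨s, hs, hsk⟩ := (csInf_lt_iff hbd hne).1 (hlt k)
    exact le_trans hs (measure_mono (Set.Iic_subset_Iic.2 hsk.le))

/-- A threshold and a probability of accepting ties for which nothing is accepted with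
probability exactly `c`. -/
theorem exists_threshold {n : ℕ} (hn : 0 < n) (μ : Fin n → Measure ℝ≥0)
    [∀ i, IsProbabilityMeasure (μ i)] {c : ℝ} (hc₀ : 0 ≤ c) (hc : c < 1) :
    ∃ (θ : ℝ≥0) (u : ℝ), u ∈ Set.Icc (0 : ℝ) 1 ∧
      ∏ i, (u * (μ i).real (Set.Iio θ) + (1 - u) * (μ i).real (Set.Iic θ)) = c := by
  have hmeas : Measurable fun x : Fin n → ℝ≥0 => Finset.univ.sup x := by fun_prop
  have : IsProbabilityMeasure ((Measure.pi μ).map fun x => Finset.univ.sup x) :=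
    Measure.isProbabilityMeasure_map hmeas.aemeasurable
  -- With `θ` a `c`-quantile of the maximum, the product is at most `c` at `u = 1` and at least `c`
  -- at `u = 0`.
  obtain ⟨θ, h₁, h₂⟩ := exists_quantile ((Measure.pi μ).map fun x => Finset.univ.sup x)
    (c := ENNReal.ofReal c) (by simpa using hc)
  have hne : (Finset.univ : Finset (Fin n)).Nonempty := ⟨⟨0, hn⟩, Finset.mem_univ _⟩
  have p₁ : ((fun x : Fin n → ℝ≥0 => Finset.univ.sup x) ⁻¹' Set.Iio θ) =
      Set.univ.pi fun _ => Set.Iio θ := by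
    ext x
    rw [Set.mem_preimage, ← Finset.sup'_eq_sup hne]
    simp
  have p₂ : ((fun x : Fin n → ℝ≥0 => Finset.univ.sup x) ⁻¹' Set.Iic θ) =
      Set.univ.pi fun _ => Set.Iic θ := by
    ext x; simp [Pi.le_def]
  rw [Measure.map_apply hmeas measurableSet_Iio, p₁, Measure.pi_pi] at h₁
  rw [Measure.map_apply hmeas measurableSet_Iic, p₂, Measure.pi_pi] at h₂
  have h₁' : ∏ i, (μ i).real (Set.Iio θ) ≤ c := by
    simpa [Measure.real, ENNReal.toReal_prod, hc₀] using ENNReal.toReal_mono (by simp) h₁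
  have h₂' : c ≤ ∏ i, (μ i).real (Set.Iic θ) := by
    simpa [Measure.real, ENNReal.toReal_prod, hc₀] using
      ENNReal.toReal_mono (ENNReal.prod_ne_top fun i _ => measure_ne_top _ _) h₂
  have hcont : ContinuousOn (fun u : ℝ =>
      ∏ i, (u * (μ i).real (Set.Iio θ) + (1 - u) * (μ i).real (Set.Iic θ))) (Set.Icc 0 1) := by
    fun_prop
  obtain ⟨u, hu, hu'⟩ := intermediate_value_Icc' zero_le_one hcont
    (show c ∈ Set.Icc _ _ from ⟨by simpa using h₁', by simpa using h₂'⟩)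
  exact ⟨θ, u, hu, hu'⟩

/-! ### A pairwise criterion for families of orders -/

/-- The truncated difference `y - θ` vanishes off `B`, so the treatment of ties affects only the
term `θ * μ B`. -/
theorem setLIntegral_eq_mul_add_excess (μ : Measure ℝ≥0) {θ : ℝ≥0} {B : Set ℝ≥0}
    (hB : MeasurableSet B) (h₁ : Set.Ioi θ ⊆ B) (h₂ : B ⊆ Set.Ici θ) :
    ∫⁻ y in B, y ∂μ = θ * μ B + ∫⁻ y, ((y - θ : ℝ≥0) : ℝ≥0∞) ∂μ := by
  rw [← lintegral_indicator hB, ← lintegral_indicator_const hB,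
    ← lintegral_add_left (measurable_const.indicator hB)]
  congr 1
  ext1 y
  by_cases hy : y ∈ B
  · rw [Set.indicator_of_mem hy, Set.indicator_of_mem hy, ← ENNReal.coe_add,
      add_tsub_cancel_of_le (h₂ hy)]
  · have : y ≤ θ := not_lt.1 fun h => hy (h₁ h)
    simp [hy, tsub_eq_zero_of_le this]

theorem lintegral_sup_le {n : ℕ} (μ : Fin n → Measure ℝ≥0) [∀ i, IsProbabilityMeasure (μ i)]
    (θ : ℝ≥0) :
    ∫⁻ x, ((Finset.univ.sup x : ℝ≥0) : ℝ≥0∞) ∂Measure.pi μ ≤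
      θ + ∑ i, ∫⁻ y, ((y - θ : ℝ≥0) : ℝ≥0∞) ∂μ i := by
  have hm : Measurable fun y : ℝ≥0 => ((y - θ : ℝ≥0) : ℝ≥0∞) := by fun_prop
  have hpt : ∀ x : Fin n → ℝ≥0, ((Finset.univ.sup x : ℝ≥0) : ℝ≥0∞) ≤
      θ + ∑ i, ((x i - θ : ℝ≥0) : ℝ≥0∞) := fun x => by
    rw [← ENNReal.ofNNReal_finsetSum, ← ENNReal.coe_add, ENNReal.coe_le_coe]
    refine Finset.sup_le fun i _ => ?_
    refine le_add_tsub.trans (add_le_add_right ?_ _)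
    exact Finset.single_le_sum (f := fun i => x i - θ) (fun _ _ => zero_le) (Finset.mem_univ i)
  refine (lintegral_mono hpt).trans (le_of_eq ?_)
  have hmi : ∀ i, Measurable fun x : Fin n → ℝ≥0 => ((x i - θ : ℝ≥0) : ℝ≥0∞) := fun i =>
    hm.comp (measurable_pi_apply i)
  rw [lintegral_add_left measurable_const, lintegral_const, measure_univ, mul_one,
    lintegral_finsetSum _ fun i _ => hmi i]
  congr 1
  exact Finset.sum_congr rfl fun i _ => (measurePreserving_eval μ i).lintegral_comp hm

/-- The contribution of `j` to the tangent-line bound at `t i` for the probability that `i` is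
reached in the order `π`. -/
noncomputable def pairScore {n : ℕ} (π : Equiv.Perm (Fin n)) (t : Fin n → ℝ) (i j : Fin n) : ℝ :=
  Real.exp (-t i) * (1 + t i - if π.symm j < π.symm i then 1 else 0)

/-- The right side is `exp (-R)`, which lies above its tangent at `t i`. As the weights sum to 1,
the constant `1 + t i` can be spread over all `j`. -/
theorem sum_mul_pairScore_le {n : ℕ} (π : Equiv.Perm (Fin n)) (t ρ : Fin n → ℝ)
    (hρ : ∀ i, 0 < ρ i) (hprod : ∏ i, ρ i = Real.exp (-1)) (i : Fin n) :
    ∑ j, -Real.log (ρ j) * pairScore π t i j ≤ ∏ l with l < π.symm i, ρ (π l) := by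
  have hsum : ∑ j, -Real.log (ρ j) = 1 := by
    rw [Finset.sum_neg_distrib, ← Real.log_prod fun j _ => (hρ j).ne', hprod, Real.log_exp, neg_neg]
  set R : ℝ := ∑ j, -Real.log (ρ j) * if π.symm j < π.symm i then 1 else 0
  have hleft : ∑ j, -Real.log (ρ j) * pairScore π t i j = Real.exp (-t i) * (1 + t i - R) := by
    have : ∀ j, -Real.log (ρ j) * pairScore π t i j = Real.exp (-t i) * ((1 + t i) * -Real.log (ρ j)
        - -Real.log (ρ j) * if π.symm j < π.symm i then 1 else 0) := fun j => by
      unfold pairScore; ring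
    rw [Finset.sum_congr rfl fun j _ => this j, ← Finset.mul_sum, Finset.sum_sub_distrib,
      ← Finset.mul_sum, hsum, mul_one]
  have hR : R = ∑ l with l < π.symm i, -Real.log (ρ (π l)) := by
    rw [Finset.sum_filter]
    refine (Equiv.sum_comp π _).symm.trans (Finset.sum_congr rfl fun l _ => ?_)
    simp
  have hright : ∏ l with l < π.symm i, ρ (π l) = Real.exp (-R) := by
    rw [hR, Finset.sum_neg_distrib, neg_neg, Real.exp_sum]
    exact Finset.prod_congr rfl fun l _ => (Real.exp_log (hρ _)).symm
  rw [hleft, hright]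
  calc Real.exp (-t i) * (1 + t i - R) ≤ Real.exp (-t i) * Real.exp (t i - R) := by
        gcongr
        linarith [Real.add_one_le_exp (t i - R)]
    _ = Real.exp (-R) := by rw [← Real.exp_add]; ring_nf

/-- The acceptance probabilities telescope, so the part paying `θ` does not depend on the order; the
excess of `i` is earned when `i` is reached. -/
theorem payoff_eq {n : ℕ} (π : Equiv.Perm (Fin n)) (ρ : Fin n → ℝ) (hρ₀ : ∀ i, 0 ≤ ρ i)
    (hρ₁ : ∀ i, ρ i ≤ 1) (θ : ℝ≥0∞) (m : Fin n → ℝ≥0∞) :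
    payoff π (fun i => (ENNReal.ofReal (ρ i), θ * ENNReal.ofReal (1 - ρ i) + m i)) =
      θ * ENNReal.ofReal (1 - ∏ i, ρ i) +
        ∑ i, ENNReal.ofReal (∏ l with l < π.symm i, ρ (π l)) * m i := by
  have h0 : ∀ k, 0 ≤ ∏ l with l < k, ρ (π l) := fun k => Finset.prod_nonneg fun l _ => hρ₀ _
  have htel : 1 - ∏ i, ρ i = ∑ k, (∏ l with l < k, ρ (π l)) * (1 - ρ (π k)) := by
    have := Finset.prod_one_sub_ordered Finset.univ fun k => 1 - ρ (π k)
    simp only [sub_sub_cancel] at this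
    rw [← Equiv.prod_comp π, this]
    rw [sub_sub_cancel]
    exact Finset.sum_congr rfl fun k _ => mul_comm _ _
  rw [htel, ENNReal.ofReal_sum_of_nonneg fun k _ => mul_nonneg (h0 k) (sub_nonneg.2 (hρ₁ _)),
    Finset.mul_sum, ← Equiv.sum_comp π (fun i => ENNReal.ofReal _ * m i), ← Finset.sum_add_distrib]
  refine Finset.sum_congr rfl fun k _ => ?_
  rw [← ENNReal.ofReal_prod_of_nonneg fun l _ => hρ₀ _, Equiv.symm_apply_apply,
    ENNReal.ofReal_mul (h0 k)]
  ring

theorem thresholdProphetInequality_of_pairScore {n : ℕ} (hn : 0 < n) {ι : Type*} [Fintype ι]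
    [Nonempty ι] (π : ι → Equiv.Perm (Fin n)) (t : ι → Fin n → ℝ) {c : ℝ}
    (hc : c ≤ 1 - 1 / Real.exp 1)
    (h : ∀ i j, c * Fintype.card ι ≤ ∑ a, pairScore (π a) (t a) i j) :
    ThresholdProphetInequality (Set.range π) c := by
  intro μ'
  let μ : Fin n → Measure ℝ≥0 := fun i => μ' i
  have : ∀ i, IsProbabilityMeasure (μ i) := fun i => (μ' i).2
  obtain ⟨θ, u, ⟨hu₀, hu₁⟩, hθ⟩ := exists_threshold hn μ (c := Real.exp (-1)) (Real.exp_pos _).le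
    (by rw [Real.exp_lt_one_iff]; norm_num)
  set ρ : Fin n → ℝ := fun i => u * (μ i).real (Set.Iio θ) + (1 - u) * (μ i).real (Set.Iic θ)
  have hu₂ : 0 ≤ 1 - u := sub_nonneg.2 hu₁
  have hρ₀ : ∀ i, 0 ≤ ρ i := fun i => by positivity
  have hρ₁ : ∀ i, ρ i ≤ 1 := fun i => by
    have h₁ : (μ i).real (Set.Iio θ) ≤ 1 := measureReal_le_one
    have h₂ : (μ i).real (Set.Iic θ) ≤ 1 := measureReal_le_one
    calc ρ i ≤ u * 1 + (1 - u) * 1 := by simp only [ρ]; gcongr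
      _ = 1 := by ring
  have hρ : ∀ i, 0 < ρ i := fun i => (hρ₀ i).lt_of_ne fun h0 => by
    rw [Finset.prod_eq_zero (Finset.mem_univ i) h0.symm] at hθ
    exact (Real.exp_pos _).ne hθ
  set m : Fin n → ℝ≥0∞ := fun i => ∫⁻ y, ((y - θ : ℝ≥0) : ℝ≥0∞) ∂μ i
  set q : Fin n → ℝ≥0∞ × ℝ≥0∞ := fun i =>
    (ENNReal.ofReal (ρ i), θ * ENNReal.ofReal (1 - ρ i) + m i)
  set M := ∫⁻ x, ((Finset.univ.sup x : ℝ≥0) : ℝ≥0∞) ∂Measure.pi μ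
  have hW : ∀ i, c * Fintype.card ι ≤ ∑ a, ∏ l with l < (π a).symm i, ρ (π a l) := fun i => by
    have hsum : ∑ j, -Real.log (ρ j) = 1 := by
      rw [Finset.sum_neg_distrib, ← Real.log_prod fun j _ => (hρ j).ne', hθ, Real.log_exp, neg_neg]
    calc c * Fintype.card ι = ∑ j, -Real.log (ρ j) * (c * Fintype.card ι) := by
          rw [← Finset.sum_mul, hsum, one_mul]
      _ ≤ ∑ j, -Real.log (ρ j) * ∑ a, pairScore (π a) (t a) i j :=
          Finset.sum_le_sum fun j _ => mul_le_mul_of_nonneg_left (h i j)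
            (neg_nonneg.2 (Real.log_nonpos (hρ₀ j) (hρ₁ j)))
      _ = ∑ a, ∑ j, -Real.log (ρ j) * pairScore (π a) (t a) i j := by
          simp_rw [Finset.mul_sum]; exact Finset.sum_comm
      _ ≤ _ := Finset.sum_le_sum fun a _ => sum_mul_pairScore_le _ _ ρ hρ hθ i
  have hmean : ∑ _a : ι, ENNReal.ofReal c * M ≤ ∑ a, payoff (π a) q := by
    have hcN : ENNReal.ofReal (c * Fintype.card ι) = Fintype.card ι * ENNReal.ofReal c := by
      rw [mul_comm, ENNReal.ofReal_mul (Nat.cast_nonneg _), ENNReal.ofReal_natCast]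
    calc ∑ _a : ι, ENNReal.ofReal c * M = Fintype.card ι * (ENNReal.ofReal c * M) := by simp
      _ ≤ Fintype.card ι * (ENNReal.ofReal c * (θ + ∑ i, m i)) := by
          gcongr; exact lintegral_sup_le μ θ
      _ = Fintype.card ι * (θ * ENNReal.ofReal c) +
            ∑ i, ENNReal.ofReal (c * Fintype.card ι) * m i := by
          rw [← Finset.mul_sum, hcN]; ring
      _ ≤ Fintype.card ι * (θ * ENNReal.ofReal (1 - ∏ i, ρ i)) +
            ∑ i, ENNReal.ofReal (∑ a, ∏ l with l < (π a).symm i, ρ (π a l)) * m i := by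
          gcongr with i
          · rw [hθ, Real.exp_neg, ← one_div]; exact hc
          · exact hW i
      _ = ∑ a, payoff (π a) q := by
          simp only [q, payoff_eq _ ρ hρ₀ hρ₁, Finset.sum_add_distrib]
          rw [Finset.sum_const, Finset.card_univ, nsmul_eq_mul, Finset.sum_comm]
          congr 1
          refine Finset.sum_congr rfl fun i _ => ?_
          rw [ENNReal.ofReal_sum_of_nonneg fun a _ => Finset.prod_nonneg fun l _ => hρ₀ _,
            Finset.sum_mul]
  -- `θ` and `u` were fixed independently of the order, so averaging over the family yields one good
  -- order.
  obtain ⟨a, -, ha⟩ := ENNReal.exists_le_of_sum_le Finset.univ_nonempty hmean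
  have hc₁ : ∀ i, 1 - (μ i).real (Set.Iio θ) = (μ i).real (Set.Ici θ) := fun i => by
    rw [← probReal_compl_eq_one_sub measurableSet_Iio, Set.compl_Iio]
  have hc₂ : ∀ i, 1 - (μ i).real (Set.Iic θ) = (μ i).real (Set.Ioi θ) := fun i => by
    rw [← probReal_compl_eq_one_sub measurableSet_Iic, Set.compl_Iic]
  have huw : ENNReal.ofReal u + ENNReal.ofReal (1 - u) = 1 := by
    rw [← ENNReal.ofReal_add hu₀ hu₂]; simp
  have hmix : ∀ x y : ℝ, 0 ≤ x → 0 ≤ y → ENNReal.ofReal (u * x + (1 - u) * y) =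
      ENNReal.ofReal u * ENNReal.ofReal x + ENNReal.ofReal (1 - u) * ENNReal.ofReal y :=
    fun x y hx hy => by
      rw [ENNReal.ofReal_add (by positivity) (by positivity), ENNReal.ofReal_mul hu₀,
        ENNReal.ofReal_mul hu₂]
  obtain ⟨A, hA⟩ := exists_le_payoff_ite (π a) q
    (fun i => (μ i (Set.Iio θ), ∫⁻ y in Set.Ici θ, y ∂μ i))
    (fun i => (μ i (Set.Iic θ), ∫⁻ y in Set.Ioi θ, y ∂μ i)) huw
    (fun i => by
      simp only [q, ρ]
      rw [hmix _ _ (by positivity) (by positivity), ofReal_measureReal, ofReal_measureReal])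
    (fun i => by
      simp only [q]
      have : 1 - ρ i = u * (μ i).real (Set.Ici θ) + (1 - u) * (μ i).real (Set.Ioi θ) := by
        rw [← hc₁, ← hc₂]; simp only [ρ]; ring
      rw [this, hmix _ _ (by positivity) (by positivity), ofReal_measureReal, ofReal_measureReal,
        setLIntegral_eq_mul_add_excess _ measurableSet_Ici Set.Ioi_subset_Ici_self subset_rfl,
        setLIntegral_eq_mul_add_excess _ measurableSet_Ioi subset_rfl Set.Ioi_subset_Ici_self]
      calc _ = ↑θ * (ENNReal.ofReal u * μ i (Set.Ici θ) + ENNReal.ofReal (1 - u) * μ i (Set.Ioi θ))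
            + (ENNReal.ofReal u + ENNReal.ofReal (1 - u)) * m i := by rw [huw, one_mul]
        _ = _ := by ring)
  let B : Fin n → Set ℝ≥0 := fun i => if i ∈ A then Set.Ici θ else Set.Ioi θ
  have hB : ∀ i, MeasurableSet (B i) := fun i => by
    simp only [B]; split_ifs
    exacts [measurableSet_Ici, measurableSet_Ioi]
  refine ⟨π a, ⟨a, rfl⟩, θ, firstHit (π a) B, isStoppingTime_firstHit hB,
    isThresholdRule_firstHit (fun i => ?_) (fun i => ?_), ?_⟩
  · simp only [B]; split_ifs
    exacts [Set.Ioi_subset_Ici_self, subset_rfl]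
  · simp only [B]; split_ifs
    exacts [subset_rfl, Set.Ioi_subset_Ici_self]
  · refine (ha.trans hA).trans (le_trans (le_of_eq ?_) (payoff_le_lintegral_selected μ hB))
    congr 1
    ext1 i
    simp only [B]
    split_ifs
    · rw [Set.compl_Ici]
    · rw [Set.compl_Ioi]

/-! ### Boundedness of the admissible factors -/

theorem selected_le_sup {n : ℕ} (π : Equiv.Perm (Fin n)) (τ : (Fin n → ℝ≥0) → WithTop (Fin n))
    (x : Fin n → ℝ≥0) : selected (reorder π) τ x ≤ Finset.univ.sup x := by
  rcases h : τ x with _ | k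
  · have : selected (reorder π) τ x = 0 := by simp only [selected, h]; rfl
    rw [this]; exact zero_le
  · have : selected (reorder π) τ x = x (π k) := by simp only [selected, h]; rfl
    rw [this]; exact Finset.le_sup (Finset.mem_univ _)

/-- Tested on variables constantly 1. Boundedness is what makes the real `sSup` in `TPR` dominate
each admissible factor. -/
theorem ThresholdProphetInequality.le_one {n : ℕ} (hn : 0 < n) {S : Set (Equiv.Perm (Fin n))}
    {α : ℝ} (h : ThresholdProphetInequality S α) : α ≤ 1 := by
  obtain ⟨π, -, θ, τ, -, -, hle⟩ := h fun _ => ⟨Measure.dirac 1, inferInstance⟩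
  have hmax : ∫⁻ x : Fin n → ℝ≥0, ((Finset.univ.sup x : ℝ≥0) : ℝ≥0∞)
      ∂(Measure.pi fun _ => Measure.dirac (1 : ℝ≥0)) = 1 := by
    have hne : (Finset.univ : Finset (Fin n)).Nonempty := ⟨⟨0, hn⟩, Finset.mem_univ _⟩
    have hae : (fun (x : Fin n → ℝ≥0) i => x i)
        =ᵐ[Measure.pi fun _ : Fin n => Measure.dirac (1 : ℝ≥0)] fun _ _ => 1 :=
      Measure.ae_eq_pi (f := fun _ y => y) (f' := fun _ _ => 1) fun _ => by
        rw [Filter.EventuallyEq, ae_dirac_eq]; rfl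
    have hsup : (fun x : Fin n → ℝ≥0 => ((Finset.univ.sup x : ℝ≥0) : ℝ≥0∞))
        =ᵐ[Measure.pi fun _ : Fin n => Measure.dirac (1 : ℝ≥0)] fun _ => 1 :=
      hae.mono fun x hx => by
        have : x = fun _ => 1 := hx
        simp only [this, Finset.sup_const hne, ENNReal.coe_one]
    rw [lintegral_congr_ae hsup, lintegral_one, measure_univ]
  have h₁ := hle.trans (lintegral_mono fun x => ENNReal.coe_le_coe.2 (selected_le_sup π τ x))
  simp only [ProbabilityMeasure.coe_mk] at h₁
  rw [hmax, mul_one] at h₁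
  simpa using h₁

theorem ThresholdProphetInequality.le_tpr {n : ℕ} (hn : 0 < n) {S : Set (Equiv.Perm (Fin n))}
    {α : ℝ} (h : ThresholdProphetInequality S α) : α ≤ TPR S :=
  le_csSup ⟨1, fun _ hβ => ThresholdProphetInequality.le_one hn hβ⟩ h

/-! ### The orders induced by affine maps over a prime field -/

theorem two_sub_mul_exp_le {x : ℝ} (hx : 0 ≤ x) : (2 - x) * Real.exp x ≤ 2 + x := by
  have hd : ∀ y : ℝ, HasDerivAt (fun y => 2 + y - (2 - y) * Real.exp y)
      (1 - (1 - y) * Real.exp y) y := fun y => by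
    have h₁ : HasDerivAt (fun y : ℝ => 2 + y) 1 y := (hasDerivAt_id y).const_add 2
    have h₂ : HasDerivAt (fun y : ℝ => 2 - y) (-1) y := (hasDerivAt_id y).const_sub 2
    convert! h₁.sub (h₂.mul (Real.hasDerivAt_exp y)) using 1
    ring
  have hmono : Monotone fun y : ℝ => 2 + y - (2 - y) * Real.exp y := by
    refine monotone_of_deriv_nonneg (fun y => (hd y).differentiableAt) fun y => ?_
    rw [(hd y).deriv]
    have : (1 - y) * Real.exp y ≤ Real.exp (-y) * Real.exp y := by
      gcongr; linarith [Real.add_one_le_exp (-y)]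
    rw [← Real.exp_add, neg_add_cancel, Real.exp_zero] at this
    linarith
  have := hmono hx
  simp only [Real.exp_zero] at this
  linarith

/-- The trapezoidal rule overestimates the integral of the convex function `exp (-x)` on `[0, 1]`,
so the sum is at least `N (1 - 1/e) + (1 + 1/e) / 2`; and `(1 + 1/e) / 2 ≥ 1 - 1/e` because `e ≤ 3`.
-/
theorem le_sum_exp_neg_div {N : ℕ} (hN : 0 < N) :
    (1 - 1 / Real.exp 1) * (N + 1) ≤ ∑ k ∈ Finset.range (N + 1), Real.exp (-(k / N : ℝ)) := by
  have hN' : (0 : ℝ) < N := by exact_mod_cast hN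
  set x : ℝ := 1 / N
  have hx : 0 < x := by positivity
  have hNx : N * x = 1 := by simp only [x]; field_simp
  set s := Real.exp (-x)
  have hs₁ : s < 1 := by rw [Real.exp_lt_one_iff]; linarith
  have hs₀ : 0 < s := Real.exp_pos _
  have hpow : s ^ N = Real.exp (-1) := by
    rw [← Real.exp_nat_mul]; congr 1; linarith
  have hsum : ∑ k ∈ Finset.range (N + 1), Real.exp (-(k / N : ℝ)) =
      (1 - Real.exp (-1) * s) / (1 - s) := by
    have : ∀ k : ℕ, Real.exp (-(k / N : ℝ)) = s ^ k := fun k => by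
      rw [← Real.exp_nat_mul]; congr 1; simp only [x]; ring
    simp_rw [this]
    rw [geom_sum_eq hs₁.ne, ← neg_div_neg_eq, pow_succ, hpow]
    ring_nf
  have hD : 1 / Real.exp 1 = Real.exp (-1) := by rw [Real.exp_neg, one_div]
  rw [hsum, hD, le_div_iff₀ (by linarith)]
  set D := Real.exp (-1)
  have hD₁ : 1 ≤ 3 * D := by
    have h₃ : Real.exp 1 ≤ 3 := Real.exp_one_lt_three.le
    have : Real.exp 1 * D = 1 := by rw [← Real.exp_add]; simp
    nlinarith [Real.exp_pos (-1)]
  -- The trapezoidal estimate after summing the geometric series; it is `two_sub_mul_exp_le` at `x =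
  -- 1 / N`.
  have hkey : 2 * N * (1 - s) ≤ 1 + s := by
    have h₁ := two_sub_mul_exp_le hx.le
    have h₂ : Real.exp x * s = 1 := by rw [← Real.exp_add]; simp
    have h₃ : (2 - x) ≤ (2 + x) * s := by
      calc 2 - x = (2 - x) * Real.exp x * s := by rw [mul_assoc, h₂, mul_one]
        _ ≤ (2 + x) * s := by gcongr
    have h₄ : N * (2 - x) ≤ N * ((2 + x) * s) := by gcongr
    nlinarith
  have hD₂ : D ≤ 1 := by rw [Real.exp_le_one_iff]; norm_num
  nlinarith [mul_le_mul_of_nonneg_left hkey (sub_nonneg.2 hD₂),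
    mul_nonneg (sub_nonneg.2 hD₁) (sub_nonneg.2 hs₁.le)]

variable {p n : ℕ}

/-- The position of `i` under the affine map with slope `ab.1` and intercept `ab.2`. -/
def affinePos (p n : ℕ) (ab : (ZMod p)ˣ × ZMod p) (i : Fin n) : ℕ :=
  ((ab.1 : ZMod p) * (i : ℕ) + ab.2).val

/-- The order in which the positions under an affine map increase. -/
def affineOrder (p n : ℕ) (ab : (ZMod p)ˣ × ZMod p) : Equiv.Perm (Fin n) :=
  Tuple.sort (affinePos p n ab)

theorem natCast_zmod_injOn (hnp : n ≤ p) :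
    Function.Injective fun i : Fin n => ((i : ℕ) : ZMod p) := fun i j h => by
  have h := (ZMod.natCast_eq_natCast_iff' _ _ _).1 h
  rw [Nat.mod_eq_of_lt (i.2.trans_le hnp), Nat.mod_eq_of_lt (j.2.trans_le hnp)] at h
  exact Fin.ext h

theorem affinePos_injective [NeZero p] (hnp : n ≤ p) (ab : (ZMod p)ˣ × ZMod p) :
    Function.Injective (affinePos p n ab) := fun i j h => by
  have h := ZMod.val_injective p h
  exact natCast_zmod_injOn hnp (ab.1.isUnit.mul_left_cancel (add_right_cancel h))

theorem affineOrder_symm_lt_iff [NeZero p] (hnp : n ≤ p) (ab : (ZMod p)ˣ × ZMod p) (i j : Fin n) :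
    (affineOrder p n ab).symm j < (affineOrder p n ab).symm i ↔
      affinePos p n ab j < affinePos p n ab i := by
  have hmono : StrictMono (affinePos p n ab ∘ affineOrder p n ab) :=
    (Tuple.monotone_sort _).strictMono_of_injective
      ((affinePos_injective hnp ab).comp (Equiv.injective _))
  have := hmono.lt_iff_lt (a := (affineOrder p n ab).symm j) (b := (affineOrder p n ab).symm i)
  simpa using this.symm

/-- A pair of distinct points is sent to each pair of distinct points by one affine map. -/
theorem affine_pair_bijective [Fact p.Prime] {c d : ZMod p} (hcd : c ≠ d) :
    Function.Bijective fun ab : (ZMod p)ˣ × ZMod p =>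
      ((⟨((ab.1 : ZMod p) * c + ab.2, (ab.1 : ZMod p) * d + ab.2), fun h =>
        hcd (ab.1.isUnit.mul_left_cancel (add_right_cancel h))⟩ :
          {xy : ZMod p × ZMod p // xy.1 ≠ xy.2})) := by
  have hsub : c - d ≠ 0 := sub_ne_zero.2 hcd
  constructor
  · rintro ⟨a, b⟩ ⟨a', b'⟩ h
    simp only [Subtype.mk.injEq, Prod.mk.injEq] at h
    obtain ⟨h₁, h₂⟩ := h
    have ha : (a : ZMod p) = a' := mul_right_cancel₀ hsub (by linear_combination h₁ - h₂)
    refine Prod.ext (Units.ext ha) ?_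
    simp only
    rw [ha] at h₁
    exact add_left_cancel h₁
  · rintro ⟨⟨x, y⟩, hxy⟩
    have hxy' : x - y ≠ 0 := sub_ne_zero.2 hxy
    refine ⟨(Units.mk0 ((x - y) / (c - d)) (div_ne_zero hxy' hsub),
      x - (x - y) / (c - d) * c), ?_⟩
    simp only [Units.val_mk0, Subtype.mk.injEq, Prod.mk.injEq]
    constructor
    · ring
    · field_simp
      ring

theorem sum_zmod_val [NeZero p] (f : ℕ → ℝ) : ∑ x : ZMod p, f x.val = ∑ k ∈ Finset.range p, f k := by
  refine Finset.sum_bij (fun x _ => x.val) (fun x _ => Finset.mem_range.2 x.val_lt)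
    (fun x _ y _ h => ZMod.val_injective p h) (fun k hk => ⟨k, Finset.mem_univ _, ?_⟩) fun _ _ => rfl
  exact ZMod.val_cast_of_lt (Finset.mem_range.1 hk)

theorem card_units_prod_zmod [Fact p.Prime] :
    Fintype.card ((ZMod p)ˣ × ZMod p) = (p - 1) * p := by
  rw [Fintype.card_prod, ZMod.card_units, ZMod.card]

/-- For `i ≠ j` the two positions run once through all ordered pairs of distinct residues. If `i` is
at `k`, a fraction `k / (p - 1)` of the positions of `j` precede it; tangency at exactly this point
leaves the average score `exp (-k / (p - 1))`. -/
theorem le_sum_pairScore_affineOrder [hp : Fact p.Prime] (hnp : n ≤ p) (i j : Fin n) :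
    (1 - 1 / Real.exp 1) * Fintype.card ((ZMod p)ˣ × ZMod p) ≤
      ∑ ab : (ZMod p)ˣ × ZMod p, pairScore (affineOrder p n ab)
        (fun i => affinePos p n ab i / ((p - 1 : ℕ) : ℝ)) i j := by
  obtain ⟨N, rfl⟩ : ∃ N, p = N + 1 := ⟨p - 1, (Nat.succ_pred hp.out.ne_zero).symm⟩
  have hN : 0 < N := by have := hp.out.two_le; omega
  have hN' : (0 : ℝ) < N := by exact_mod_cast hN
  have hcard : (Fintype.card ((ZMod (N + 1))ˣ × ZMod (N + 1)) : ℝ) = N * (N + 1) := by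
    rw [card_units_prod_zmod]; push_cast [Nat.add_sub_cancel]; ring
  have hexp := le_sum_exp_neg_div hN
  rw [hcard, Nat.add_sub_cancel]
  have hgoal : (1 - 1 / Real.exp 1) * (N * (N + 1) : ℝ) ≤
      N * ∑ k ∈ Finset.range (N + 1), Real.exp (-(k / N : ℝ)) := by
    nlinarith [mul_le_mul_of_nonneg_left hexp hN'.le]
  refine hgoal.trans ?_
  simp only [pairScore, affineOrder_symm_lt_iff hnp]
  by_cases hij : i = j
  · subst hij
    -- On the diagonal the indicator is 0 and the factor `1 + t` only helps.
    simp only [lt_irrefl, if_false, sub_zero]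
    have hrow : ∀ a : (ZMod (N + 1))ˣ, ∑ k ∈ Finset.range (N + 1), Real.exp (-(k / N : ℝ)) ≤
        ∑ b, Real.exp (-(affinePos (N + 1) n (a, b) i / N : ℝ)) *
          (1 + affinePos (N + 1) n (a, b) i / N) := fun a => by
      rw [← sum_zmod_val fun k => Real.exp (-(k / N : ℝ)),
        ← Equiv.sum_comp (Equiv.addLeft ((a : ZMod (N + 1)) * (i : ℕ)))]
      refine Finset.sum_le_sum fun b _ => ?_
      refine le_mul_of_one_le_right (Real.exp_pos _).le ?_
      have : (0 : ℝ) ≤ affinePos (N + 1) n (a, b) i / N := by positivity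
      linarith
    rw [Fintype.sum_prod_type]
    refine le_trans (le_of_eq ?_) (Finset.sum_le_sum fun a _ => hrow a)
    rw [Finset.sum_const, Finset.card_univ, ZMod.card_units, Nat.add_sub_cancel, nsmul_eq_mul]
  · have hcd : ((i : ℕ) : ZMod (N + 1)) ≠ ((j : ℕ) : ZMod (N + 1)) := fun h =>
      hij (natCast_zmod_injOn hnp h)
    let F : ZMod (N + 1) → ZMod (N + 1) → ℝ := fun x y =>
      Real.exp (-(x.val / N : ℝ)) * (1 + x.val / N - if y.val < x.val then 1 else 0)
    have hsum := (affine_pair_bijective hcd).sum_comp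
      (fun xy : {xy : ZMod (N + 1) × ZMod (N + 1) // xy.1 ≠ xy.2} => F xy.1.1 xy.1.2)
    refine le_of_le_of_eq ?_ hsum.symm
    have hsub : ∑ xy : {xy : ZMod (N + 1) × ZMod (N + 1) // xy.1 ≠ xy.2}, F xy.1.1 xy.1.2 =
        ∑ x, ∑ y, if x ≠ y then F x y else 0 := by
      rw [← Fintype.sum_prod_type' (f := fun x y => if x ≠ y then F x y else 0),
        ← Finset.sum_filter]
      exact (Finset.sum_subtype _ (by simp) fun xy : ZMod (N + 1) × ZMod (N + 1) =>
        F xy.1 xy.2).symm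
    rw [hsub, ← sum_zmod_val fun k => Real.exp (-(k / N : ℝ)), Finset.mul_sum]
    refine Finset.sum_le_sum fun x _ => le_of_eq ?_
    have h₁ : ∑ y : ZMod (N + 1), (if y.val < x.val then (1 : ℝ) else 0) = x.val := by
      rw [sum_zmod_val fun k => if k < x.val then (1 : ℝ) else 0, ← Finset.sum_filter]
      have : (Finset.range (N + 1)).filter (· < x.val) = Finset.range x.val := by
        ext k
        simp only [Finset.mem_filter, Finset.mem_range]
        have := x.val_lt
        omega
      simp [this]
    -- Summed over `y`, the bracket is `(N + 1)(1 + x/N) - x - (1 + x/N) = N`.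
    have h₂ : ∀ y, (if x ≠ y then F x y else 0) =
        Real.exp (-(x.val / N : ℝ)) * ((1 + x.val / N : ℝ) - (if y.val < x.val then (1 : ℝ) else 0) -
          if x = y then (1 + x.val / N : ℝ) else 0) := fun y => by
      by_cases hxy : x = y
      · subst hxy; simp
      · simp [hxy, F]
    simp_rw [h₂]
    rw [← Finset.mul_sum, Finset.sum_sub_distrib, Finset.sum_sub_distrib, h₁, Finset.sum_const,
      Finset.card_univ, ZMod.card, Finset.sum_ite_eq, if_pos (Finset.mem_univ _), nsmul_eq_mul]
    push_cast
    field_simp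
    ring

theorem pairScore_affineOrder_mem_Icc (ab : (ZMod p)ˣ × ZMod p)
    (i j : Fin n) :
    pairScore (affineOrder p n ab) (fun i => affinePos p n ab i / ((p - 1 : ℕ) : ℝ)) i j ∈
      Set.Icc (0 : ℝ) 1 := by
  set t : ℝ := affinePos p n ab i / ((p - 1 : ℕ) : ℝ)
  have ht : 0 ≤ t := by positivity
  have hle : Real.exp (-t) * (1 + t) ≤ 1 := by
    calc Real.exp (-t) * (1 + t) ≤ Real.exp (-t) * Real.exp t := by
          gcongr; linarith [Real.add_one_le_exp t]
      _ = 1 := by rw [← Real.exp_add]; simp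
  have hpos := Real.exp_pos (-t)
  simp only [pairScore]
  constructor
  · refine mul_nonneg hpos.le ?_
    split_ifs <;> linarith
  · refine le_trans (mul_le_mul_of_nonneg_left ?_ hpos.le) hle
    split_ifs <;> linarith

/-! ### Sampling -/

/-- If finitely many `[0, 1]`-valued functions on a finite set all have mean at least `D`, then
logarithmically many sample points suffice for all empirical means to be at least `D - δ`. -/
theorem exists_sample {Ω P : Type*} [Fintype Ω] [Nonempty Ω] [Fintype P] [Nonempty P]
    (g : P → Ω → ℝ) (hg : ∀ p a, g p a ∈ Set.Icc (0 : ℝ) 1) {D : ℝ} (hD₀ : 0 ≤ D) (hD₁ : D ≤ 1)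
    (hmean : ∀ p, D * Fintype.card Ω ≤ ∑ a, g p a) {δ : ℝ} (hδ₀ : 0 < δ) (hδ₂ : δ ≤ 2) {m : ℕ}
    (hm : 4 * Real.log (Fintype.card P) ≤ δ ^ 2 * m) :
    ∃ s : Fin m → Ω, ∀ p, (D - δ) * m ≤ ∑ l, g p (s l) := by
  -- Exponent of a Chernoff bound: the hypothesis on `m` becomes `log |P| ≤ r² m`, whence `log |P| +
  -- r² m ≤ r δ m`.
  set r : ℝ := δ / 2
  have hr₀ : 0 < r := by positivity
  have hr₁ : r ≤ 1 := by simp only [r]; linarith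
  have hone : ∀ p a, Real.exp (r * (D - g p a)) ≤ 1 + r * (D - g p a) + r ^ 2 := fun p a => by
    obtain ⟨h₀, h₁⟩ := hg p a
    have habs : |D - g p a| ≤ 1 := abs_le.2 ⟨by linarith, by linarith⟩
    have hx : |r * (D - g p a)| ≤ 1 := by
      rw [abs_mul, abs_of_pos hr₀]
      exact mul_le_one₀ hr₁ (abs_nonneg _) habs
    have h := (abs_le.1 (Real.abs_exp_sub_one_sub_id_le hx)).2
    have hsq : (r * (D - g p a)) ^ 2 ≤ r ^ 2 := by
      rw [mul_pow]
      refine mul_le_of_le_one_right (sq_nonneg _) ?_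
      rw [← sq_abs]
      exact pow_le_one₀ (abs_nonneg _) habs
    linarith
  have hmgf : ∀ p, ∑ a, Real.exp (r * (D - g p a)) ≤ Fintype.card Ω * Real.exp (r ^ 2) :=
    fun p => by
    calc ∑ a, Real.exp (r * (D - g p a)) ≤ ∑ a, (1 + r * (D - g p a) + r ^ 2) :=
          Finset.sum_le_sum fun a _ => hone p a
      _ = Fintype.card Ω * (1 + r ^ 2) + r * (D * Fintype.card Ω - ∑ a, g p a) := by
          simp only [Finset.sum_add_distrib, ← Finset.mul_sum, Finset.sum_sub_distrib,
            Finset.sum_const, Finset.card_univ, nsmul_eq_mul]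
          ring
      _ ≤ Fintype.card Ω * (1 + r ^ 2) + r * 0 := by
          gcongr; linarith [hmean p]
      _ ≤ Fintype.card Ω * Real.exp (r ^ 2) := by
          rw [mul_zero, add_zero]
          gcongr
          linarith [Real.add_one_le_exp (r ^ 2)]
  -- Summing the exponential moments over `p` is the union bound: a sample no worse than average
  -- controls every `p` at once.
  have htotal : ∑ s : Fin m → Ω, ∑ p, Real.exp (r * ∑ l, (D - g p (s l))) ≤
      ∑ _s : Fin m → Ω, Fintype.card P * Real.exp (m * r ^ 2) := by
    rw [Finset.sum_comm]
    calc ∑ p, ∑ s : Fin m → Ω, Real.exp (r * ∑ l, (D - g p (s l)))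
        = ∑ p, (∑ a, Real.exp (r * (D - g p a))) ^ m := by
          refine Finset.sum_congr rfl fun p _ => ?_
          rw [Fintype.sum_pow]
          refine Finset.sum_congr rfl fun s _ => ?_
          rw [Finset.mul_sum, Real.exp_sum]
      _ ≤ ∑ _p : P, (Fintype.card Ω * Real.exp (r ^ 2)) ^ m :=
          Finset.sum_le_sum fun p _ =>
            pow_le_pow_left₀ (Finset.sum_nonneg fun a _ => (Real.exp_pos _).le) (hmgf p) m
      _ = _ := by
          simp only [Finset.sum_const, Finset.card_univ, nsmul_eq_mul, Fintype.card_fun,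
            Fintype.card_fin, mul_pow, ← Real.exp_nat_mul]
          push_cast
          ring
  obtain ⟨s, -, hs⟩ := Finset.exists_le_of_sum_le Finset.univ_nonempty htotal
  refine ⟨s, fun p => ?_⟩
  have hcard : (0 : ℝ) < Fintype.card P := by exact_mod_cast Fintype.card_pos
  have h := (Finset.single_le_sum (f := fun p => Real.exp (r * ∑ l, (D - g p (s l))))
    (fun _ _ => (Real.exp_pos _).le) (Finset.mem_univ p)).trans hs
  rw [← Real.exp_log hcard, ← Real.exp_add, Real.exp_le_exp, Finset.sum_sub_distrib,
    Finset.sum_const, Finset.card_univ, Fintype.card_fin, nsmul_eq_mul] at h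
  have hδ : δ = 2 * r := by simp only [r]; ring
  rw [hδ] at hm ⊢
  have h' : r * (m * D - ∑ l, g p (s l)) ≤ r * (2 * r * m) := by linarith
  have := le_of_mul_le_mul_left h' hr₀
  linarith

/-! ### The two families of orders -/

theorem one_sub_one_div_exp_mem_Icc : 1 - 1 / Real.exp 1 ∈ Set.Icc (0 : ℝ) 1 := by
  have : 1 / Real.exp 1 ≤ 1 := by
    rw [div_le_one (Real.exp_pos _)]; exact Real.one_le_exp zero_le_one
  have : 0 < 1 / Real.exp 1 := by positivity
  constructor <;> linarith

theorem exists_finset_card_le_sq {n : ℕ} (hn : 1 ≤ n) :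
    ∃ S : Finset (Equiv.Perm (Fin n)), S.Nonempty ∧ (S.card : ℝ) ≤ 4 * (n : ℝ) ^ 2 ∧
      1 - 1 / Real.exp 1 ≤ TPR (S : Set (Equiv.Perm (Fin n))) := by
  classical
  obtain ⟨p, hp, hnp, hp2⟩ := Nat.exists_prime_lt_and_le_two_mul n (by omega)
  have : Fact p.Prime := ⟨hp⟩
  refine ⟨Finset.univ.image (affineOrder p n), Finset.univ_nonempty.image _, ?_, ?_⟩
  · have hcard : (Finset.univ.image (affineOrder p n)).card ≤ 4 * n ^ 2 := by
      refine Finset.card_image_le.trans ?_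
      rw [Finset.card_univ, card_units_prod_zmod]
      calc (p - 1) * p ≤ (2 * n) * (2 * n) := Nat.mul_le_mul ((Nat.sub_le _ _).trans hp2) hp2
        _ = 4 * n ^ 2 := by ring
    exact_mod_cast hcard
  · rw [Finset.coe_image, Finset.coe_univ, Set.image_univ]
    exact (thresholdProphetInequality_of_pairScore hn (affineOrder p n) _ le_rfl
      fun i j => le_sum_pairScore_affineOrder hnp.le i j).le_tpr hn

theorem exists_finset_card_le_log {n : ℕ} (hn : 2 ≤ n) {ε : ℝ} (hε : 0 < ε) :
    ∃ S : Finset (Equiv.Perm (Fin n)), S.Nonempty ∧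
      (S.card : ℝ) ≤ (32 * (1 / ε) ^ 2 + 10) * Real.log n ∧
      1 - 1 / Real.exp 1 - ε < TPR (S : Set (Equiv.Perm (Fin n))) := by
  classical
  have hn₀ : 0 < n := by omega
  obtain ⟨p, hp, hnp, -⟩ := Nat.exists_prime_lt_and_le_two_mul n (by omega)
  have : Fact p.Prime := ⟨hp⟩
  have : Nonempty (Fin n) := ⟨⟨0, hn₀⟩⟩
  -- Halving `ε` gives the strict inequality; the cap at 1 keeps `δ` in the range of `exists_sample`
  -- for large `ε`.
  set δ : ℝ := min (ε / 2) 1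
  have hδ₀ : 0 < δ := lt_min (by positivity) one_pos
  have hδ₁ : δ ≤ 1 := min_le_right _ _
  have hδε : δ < ε := (min_le_left _ _).trans_lt (by linarith)
  have hlog : 1 ≤ 2 * Real.log n := by
    have h₁ : Real.log 2 ≤ Real.log n := Real.log_le_log two_pos (by exact_mod_cast hn)
    linarith [Real.log_two_gt_d9]
  -- `8 log n = 4 log (n²)` for the `n²` pairs. Rounding up costs at most `1 ≤ 2 log n`, so the
  -- coefficient is `8 (4/ε² + 1) + 2 = 32/ε² + 10`.
  set m : ℕ := ⌈8 * Real.log n / δ ^ 2⌉₊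
  have hm : 8 * Real.log n ≤ δ ^ 2 * m := by
    have := Nat.le_ceil (8 * Real.log n / δ ^ 2)
    rwa [div_le_iff₀' (by positivity)] at this
  have hm₀ : 0 < m := Nat.ceil_pos.2 (div_pos (by linarith) (by positivity))
  have hmle : (m : ℝ) ≤ (32 * (1 / ε) ^ 2 + 10) * Real.log n := by
    have h₁ : (m : ℝ) < 8 * Real.log n / δ ^ 2 + 1 := Nat.ceil_lt_add_one (by positivity)
    have h₂ : 1 / δ ^ 2 ≤ 4 * (1 / ε) ^ 2 + 1 := by
      rcases min_choice (ε / 2) 1 with h | h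
      · have : δ = ε / 2 := h
        rw [this]
        have : 1 / (ε / 2) ^ 2 = 4 * (1 / ε) ^ 2 := by field_simp; norm_num
        linarith
      · have : δ = 1 := h
        rw [this]
        have : 0 ≤ (1 / ε) ^ 2 := by positivity
        linarith
    have h₃ : 8 * Real.log n * (1 / δ ^ 2) ≤ 8 * Real.log n * (4 * (1 / ε) ^ 2 + 1) := by
      gcongr
    rw [mul_one_div] at h₃
    linarith
  have hlogP : 4 * Real.log (Fintype.card (Fin n × Fin n)) ≤ δ ^ 2 * m := by
    rw [Fintype.card_prod, Fintype.card_fin, Nat.cast_mul, Real.log_mul (by positivity)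
      (by positivity)]
    linarith
  obtain ⟨s, hs⟩ := exists_sample
    (fun (ij : Fin n × Fin n) (ab : (ZMod p)ˣ × ZMod p) => pairScore (affineOrder p n ab)
      (fun i => affinePos p n ab i / ((p - 1 : ℕ) : ℝ)) ij.1 ij.2)
    (fun ij ab => pairScore_affineOrder_mem_Icc ab ij.1 ij.2)
    one_sub_one_div_exp_mem_Icc.1 one_sub_one_div_exp_mem_Icc.2
    (fun ij => le_sum_pairScore_affineOrder hnp.le ij.1 ij.2) hδ₀ (by linarith) hlogP
  have : Nonempty (Fin m) := ⟨⟨0, hm₀⟩⟩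
  refine ⟨Finset.univ.image (affineOrder p n ∘ s), Finset.univ_nonempty.image _, ?_, ?_⟩
  · refine le_trans ?_ hmle
    have h : (Finset.univ.image (affineOrder p n ∘ s)).card ≤ m :=
      Finset.card_image_le.trans (by simp)
    exact_mod_cast h
  · rw [Finset.coe_image, Finset.coe_univ, Set.image_univ]
    refine lt_of_lt_of_le (sub_lt_sub_left hδε _) ?_
    refine (thresholdProphetInequality_of_pairScore hn₀ (affineOrder p n ∘ s)
      (fun l i => affinePos p n (s l) i / ((p - 1 : ℕ) : ℝ)) (by linarith) fun i j => ?_).le_tpr hn₀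
    rw [Fintype.card_fin]
    exact hs (i, j)

end Prophet

theorem theorem3 :
    (∃ P : Polynomial ℝ, ∀ n : ℕ, 2 ≤ n → ∀ ε : ℝ, 0 < ε →
      ∃ S : Finset (Equiv.Perm (Fin n)), S.Nonempty ∧
        (S.card : ℝ) ≤ P.eval (1 / ε) * Real.log n ∧
        1 - 1 / Real.exp 1 - ε < Prophet.TPR (S : Set (Equiv.Perm (Fin n)))) ∧
    (∃ C : ℝ, ∀ n : ℕ, 1 ≤ n →
      ∃ S : Finset (Equiv.Perm (Fin n)), S.Nonempty ∧
        (S.card : ℝ) ≤ C * (n : ℝ) ^ 2 ∧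
        1 - 1 / Real.exp 1 ≤ Prophet.TPR (S : Set (Equiv.Perm (Fin n)))) := by
  refine ⟨⟨32 * Polynomial.X ^ 2 + 10, fun n hn ε hε => ?_⟩, 4, fun n hn => ?_⟩
  · simpa using Prophet.exists_finset_card_le_log hn hε
  · exact Prophet.exists_finset_card_le_sq hn
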